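/- For an odd integer $q\ge 3$ let $W$ be the typewriter channel on $\mathbb{Z}_q$ with crossover probability $1/2$: input $x$ is received as $x$ or $x+1$, each with probability $1/2$. Logarithms are to base $2$. Let $$E(R)=\limsup_{n\to\infty}\frac1n\log\frac1{\mathsf P_{\mathrm e}(\lceil 2^{nR}\rceil,n)}\in[0,+\infty]$$ be its reliability function, where $\mathsf P_{\mathrm e}(M,n)$ is the smallest probability of error (average or maximal over the codewords; the statement holds for both) of codes with $M$ codewords of length $n$, over all possibly randomized decoders, used on the $n$-fold memoryless extension of $W$. For real $Q>1$ put $$H_Q(t)=t\log(Q-1)-t\log t-(1-t)\log(1-t),\qquad R_{\mathrm{LP1}}(Q,\delta)=H_Q\!\left(\frac{(Q-1)-(Q-2)\delta-2\sqrt{(Q-1)\delta(1-\delta)}}{Q}\right),$$ with $0\log 0=0$. **Theorem.** Let $q=5$. The map $E\mapsto \log\sqrt5+R_{\mathrm{LP1}}(\sqrt5,E)$ is a bijection from $[0,1-1/\sqrt5]$ onto $[\log\sqrt5,\log 5]$; let $E_{\mathrm{LP1}}$ be its inverse. Then $E(R)\le E_{\mathrm{LP1}}(R)$ for all $\log\sqrt5<R<\log(5/2)$.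 More generally, for every odd $q\ge3$ put $q'=1+\frac1{\cos(\pi/q)}$ and $r_q=\log\frac{q\cos(\pi/q)}{1+\cos(\pi/q)}$. The map $E\mapsto r_q+R_{\mathrm{LP1}}(q',E)$ is a bijection from $[0,1-1/q']$ onto $[r_q,\log q]$, and $E(R)$ is at most the value at $R$ of its inverse, for all $r_q<R<\log(q/2)$. -/

import Mathlib

open Set Filter

namespace Typewriter

noncomputable section

/-- Transition probability `W(y | x)` of the typewriter channel on `ZMod q` with crossover
probability `1/2`: the input `x` is received as `x` or as `x + 1`, each with probability `1/2`. -/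
def W {q : ℕ} (y x : ZMod q) : ℝ := if y = x ∨ y = x + 1 then 1 / 2 else 0

/-- The `n`-fold memoryless extension of the channel. -/
def Wn {q n : ℕ} (y x : Fin n → ZMod q) : ℝ := ∏ k, W (y k) (x k)

/-- A code with `M` codewords of length `n`, together with a (possibly randomized) decoder:
`dec y m` is the probability that message `m` is decided when `y` is received. -/
structure Code (q n M : ℕ) where
  enc : Fin M → Fin n → ZMod q
  dec : (Fin n → ZMod q) → Fin M → ℝ
  dec_nonneg : ∀ y m, 0 ≤ dec y m
  dec_sum : ∀ y, ∑ m, dec y m = 1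

/-- Probability of a decoding error when message `m` is sent. -/
def Code.err {q n M : ℕ} [NeZero q] (c : Code q n M) (m : Fin M) : ℝ :=
  ∑ y : Fin n → ZMod q, Wn y (c.enc m) * (1 - c.dec y m)

/-- Average probability of error over the codewords. -/
def Code.avgErr {q n M : ℕ} [NeZero q] (c : Code q n M) : ℝ := (∑ m, c.err m) / M

/-- Maximal probability of error over the codewords. -/
def Code.maxErr {q n M : ℕ} [NeZero q] (c : Code q n M) : ℝ := ⨆ m, c.err m

/-- Smallest average probability of error of codes with `M` codewords of length `n`. -/
def PeAvg (q : ℕ) [NeZero q] (M n : ℕ) : ℝ := ⨅ c : Code q n M, c.avgErr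

/-- Smallest maximal probability of error of codes with `M` codewords of length `n`. -/
def PeMax (q : ℕ) [NeZero q] (M n : ℕ) : ℝ := ⨅ c : Code q n M, c.maxErr

/-- `(1/n) log₂ (1/p)`, equal to `+∞` when `p = 0`. -/
def errExponent (p : ℝ) (n : ℕ) : EReal :=
  if p = 0 then ⊤ else (((1 / (n : ℝ)) * Real.logb 2 (1 / p) : ℝ) : EReal)

/-- `limsup_n (1/n) log₂ (1 / Pe(⌈2^{nR}⌉, n))`. -/
def reliability (Pe : ℕ → ℕ → ℝ) (R : ℝ) : EReal :=
  limsup (fun n : ℕ => errExponent (Pe ⌈(2 : ℝ) ^ ((n : ℝ) * R)⌉₊ n) n) atTop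

/-- The reliability function of the `q`-input channel, for the average probability of error. -/
def EAvg (q : ℕ) [NeZero q] (R : ℝ) : EReal := reliability (PeAvg q) R

/-- The reliability function of the `q`-input channel, for the maximal probability of error. -/
def EMax (q : ℕ) [NeZero q] (R : ℝ) : EReal := reliability (PeMax q) R

/-- The `Q`-ary entropy function (in bits), for a real parameter `Q`. -/
def entropy (Q t : ℝ) : ℝ :=
  t * Real.logb 2 (Q - 1) - t * Real.logb 2 t - (1 - t) * Real.logb 2 (1 - t)

/-- The first linear programming bound, for a real alphabet size `Q`. -/
def RLP1 (Q δ : ℝ) : ℝ :=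
  entropy Q (((Q - 1) - (Q - 2) * δ - 2 * √((Q - 1) * δ * (1 - δ))) / Q)

/-- The map `E ↦ r₀ + R_LP1(Q, E)`. -/
def rateLP1 (r₀ Q E : ℝ) : ℝ := r₀ + RLP1 Q E

/-- The inverse function of `E ↦ r₀ + R_LP1(Q, E)` on `0 ≤ E ≤ 1 - 1 / Q`. -/
def ELP1 (r₀ Q R : ℝ) : ℝ :=
  Function.invFunOn (rateLP1 r₀ Q) (Icc 0 (1 - 1 / Q)) R

/-- The Lovász bound (in bits) for the cycle with `q` vertices, `q` odd. -/
def lovaszRate (q : ℕ) : ℝ :=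
  Real.logb 2 (q * Real.cos (Real.pi / q) / (1 + Real.cos (Real.pi / q)))

/-- The non-integer alphabet size `1 + 1 / cos (π / q)`. -/
def altSize (q : ℕ) : ℝ := 1 + 1 / Real.cos (Real.pi / q)

end

end Typewriter

/-! If two codewords are equal or adjacent on the cycle in every coordinate and differ in `d`
places, their error probabilities add up to at least `2 ^ (-d)`. Hence the exponent is at most `δ`
as soon as the better half of every code of the given rate contains a confusable pair at distance
below `δ n`. This mixes a minimum distance problem with Lovász's zero-error problem, and both are
treated by one linear program.

Put `C = cos (π / q)` and `Q = 1 + 1 / C`. The Lovász kernel, with values `1` at `0` and `1 / (2C)`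
at `±1`, is positive definite, and its product `G` vanishes on pairs that are not confusable.
Multiplication by `ρ` (`1` at `0`, `-C` elsewhere) turns `1 / (2C)` into `-1 / 2`, which kills the
trivial Fourier coefficient; a second multiplication gives `C / 2`. So, measured by the trivial
coefficient after weighting by `G`, the products of `ρ` over sets `S` are orthogonal with squared
norms proportional to `C ^ |S|`, as in a Hamming scheme with the real alphabet size `Q`.

The first linear programming argument runs in this fictitious scheme. The test function is `G (∑ ρ -
λ) φ²`, with `φ` a nonnegative approximate eigenvector of multiplication by `∑ ρ`. Summed over pairs
of codewords, it is bounded below by positivity and above by its diagonal (`card_mul_le`). With `φ`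
concentrated near level `τ n`, the code has size at most a constant times `(q C / (1 + C)) ^ n`
times the bound `2 ^ (n H_Q(τ))` on a `Q`-ary ball (`card_le_of_flip_lt`), provided `flip Q τ < δ`.
As `flip Q` is an involution, this is the rate `r_q + R_LP1(Q, δ)` in the limit. -/

namespace Typewriter

/-! ### Positive definite kernels on the cycle -/

section Kernel

variable {q n : ℕ} {ι : Type*} [Fintype ι]

/-- A product of positive definite kernels on `ZMod q`, summed over all pairs of a finite family,
is at least the contribution of the trivial character. -/
theorem sum_prod_kernel_ge [NeZero q] (w K : Fin n → ZMod q → ℝ) (hw : ∀ k ω, 0 ≤ w k ω)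
    (hK : ∀ k z, (K k z : ℂ) = ∑ ω, (w k ω : ℂ) * ZMod.stdAddChar (ω * z))
    (c : ι → Fin n → ZMod q) :
    (∏ k, w k 0) * (Fintype.card ι : ℝ) ^ 2 ≤ ∑ i, ∑ j, ∏ k, K k (c i k - c j k) := by
  classical
  set u : (Fin n → ZMod q) → ι → ℂ := fun ω i => ∏ k, ZMod.stdAddChar (ω k * c i k) with hu
  have key : ((∑ i, ∑ j, ∏ k, K k (c i k - c j k) : ℝ) : ℂ)
      = ((∑ ω : Fin n → ZMod q, (∏ k, w k (ω k)) * Complex.normSq (∑ i, u ω i) : ℝ) : ℂ) := by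
    push_cast
    have h1 : ∀ i j, ∏ k, (K k (c i k - c j k) : ℂ)
        = ∑ ω : Fin n → ZMod q, (∏ k, (w k (ω k) : ℂ)) * (u ω i * (starRingEnd ℂ) (u ω j)) := by
      intro i j
      simp_rw [hK]
      rw [Finset.prod_univ_sum, Fintype.piFinset_univ]
      refine Finset.sum_congr rfl fun ω _ => ?_
      rw [hu]
      simp only [map_prod]
      rw [← Finset.prod_mul_distrib, ← Finset.prod_mul_distrib]
      refine Finset.prod_congr rfl fun k _ => ?_
      rw [mul_sub, sub_eq_add_neg, AddChar.map_add_eq_mul, AddChar.map_neg_eq_conj]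
    simp_rw [h1, Complex.normSq_eq_conj_mul_self, map_sum, Finset.sum_mul_sum, Finset.mul_sum]
    rw [Finset.sum_comm]
    simp_rw [Finset.sum_comm (s := (Finset.univ : Finset ι)) (t := (Finset.univ : Finset (Fin n → ZMod q)))]
    refine Finset.sum_congr rfl fun ω _ => Finset.sum_congr rfl fun i _ =>
      Finset.sum_congr rfl fun j _ => ?_
    ring
  rw [Complex.ofReal_inj.mp key]
  -- Every frequency contributes a nonnegative term; only the zero frequency is kept, where each `u
  -- 0 i` equals `1`.
  have h0 := Finset.single_le_sum (s := Finset.univ)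
    (f := fun ω : Fin n → ZMod q => (∏ k, w k (ω k)) * Complex.normSq (∑ i, u ω i))
    (fun ω _ => mul_nonneg (Finset.prod_nonneg fun k _ => hw _ _) (Complex.normSq_nonneg _))
    (Finset.mem_univ 0)
  refine le_trans (le_of_eq ?_) h0
  simp [hu, Complex.normSq_natCast, sq]

/-- The kernel `1_{0} + a (1_{1} + 1_{-1})`. -/
noncomputable def stepKernel (q : ℕ) (a : ℝ) (z : ZMod q) : ℝ :=
  if z = 0 then 1 else if z = 1 ∨ z = -1 then a else 0

/-- The Fourier coefficients of `stepKernel`. -/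
noncomputable def stepWeight (q : ℕ) (a : ℝ) (ω : ZMod q) : ℝ :=
  (1 + 2 * a * Real.cos (2 * Real.pi * ω.val / q)) / q

theorem ne_of_three_le (hq : 3 ≤ q) : (1 : ZMod q) ≠ 0 ∧ (1 : ZMod q) ≠ -1 := by
  have : Fact (1 < q) := ⟨by omega⟩
  have : Fact (2 < q) := ⟨by omega⟩
  exact ⟨one_ne_zero, (ZMod.neg_one_ne_one).symm⟩

theorem stepKernel_eq [NeZero q] (hq : 3 ≤ q) (a : ℝ) (z : ZMod q) :
    (stepKernel q a z : ℂ) = ∑ ω, (stepWeight q a ω : ℂ) * ZMod.stdAddChar (ω * z) := by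
  obtain ⟨h1, h2⟩ := ne_of_three_le hq
  have hq0 : (q : ℂ) ≠ 0 := by exact_mod_cast NeZero.ne q
  have hcos : ∀ ω : ZMod q, 2 * (Real.cos (2 * Real.pi * ω.val / q) : ℂ)
      = ZMod.stdAddChar ω + ZMod.stdAddChar (-ω) := by
    intro ω
    rw [AddChar.map_neg_eq_inv, ZMod.stdAddChar_apply, ZMod.toCircle_apply]
    rw [← Complex.exp_neg, Complex.ofReal_cos, Complex.two_cos]
    push_cast
    congr 2 <;> ring
  have horth : ∀ y : ZMod q, ∑ ω : ZMod q, ZMod.stdAddChar (N := q) (ω * y)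
      = if y = 0 then (q : ℂ) else 0 := by
    intro y
    have := AddChar.sum_mulShift (R := ZMod q) (R' := ℂ) y (ZMod.isPrimitive_stdAddChar q)
    simpa [ZMod.card] using this
  have hterm : ∀ ω : ZMod q, (stepWeight q a ω : ℂ) * ZMod.stdAddChar (ω * z)
      = (ZMod.stdAddChar (ω * z) + a * (ZMod.stdAddChar (ω * (z + 1))
        + ZMod.stdAddChar (ω * (z - 1)))) / q := by
    intro ω
    have : (stepWeight q a ω : ℂ) = (1 + a * (2 * (Real.cos (2 * Real.pi * ω.val / q) : ℂ))) / q := by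
      rw [stepWeight]; push_cast; ring
    rw [this, hcos, mul_add ω, mul_sub, mul_one, sub_eq_add_neg, AddChar.map_add_eq_mul,
      AddChar.map_add_eq_mul]
    ring
  simp_rw [hterm]
  rw [← Finset.sum_div, Finset.sum_add_distrib, ← Finset.mul_sum, Finset.sum_add_distrib, horth,
    horth, horth, stepKernel]
  by_cases hz : z = 0
  · subst hz
    simp [h1, hq0]
  · by_cases hz1 : z = 1
    · subst hz1
      have : (1 : ZMod q) + 1 ≠ 0 := fun h => h2 (eq_neg_of_add_eq_zero_left h)
      simp [h1, this, hq0]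
    · by_cases hz2 : z = -1
      · subst hz2
        have : (-1 : ZMod q) - 1 ≠ 0 := fun h => h2 (sub_eq_zero.mp h).symm
        simp [h1, this, hq0]
      · have e1 : z + 1 ≠ 0 := fun h => hz2 (eq_neg_of_add_eq_zero_left h)
        have e2 : z - 1 ≠ 0 := fun h => hz1 (sub_eq_zero.mp h)
        simp [hz, hz1, hz2, e1, e2]

/-- For odd `q` no multiple of `2π / q` comes closer to `π` than `π / q`. Angles in the upper half
circle follow by monotonicity, the others by the reflection `j ↦ q - j`. -/
theorem neg_cos_le_cos [NeZero q] (hq : Odd q) (j : ℕ) (hj : j < q) :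
    -Real.cos (Real.pi / q) ≤ Real.cos (2 * Real.pi * j / q) := by
  have hq0 : (0 : ℝ) < q := by exact_mod_cast Nat.pos_of_ne_zero (NeZero.ne q)
  have main : ∀ i : ℕ, 2 * i + 1 ≤ q →
      -Real.cos (Real.pi / q) ≤ Real.cos (2 * Real.pi * i / q) := by
    intro i hi
    rw [← Real.cos_pi_sub]
    have hi' : (2 * i + 1 : ℝ) ≤ q := by exact_mod_cast hi
    apply Real.cos_le_cos_of_nonneg_of_le_pi
    · positivity
    · have : 0 ≤ Real.pi / q := by positivity
      linarith
    · rw [div_le_iff₀ hq0, sub_mul, div_mul_cancel₀ _ hq0.ne']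
      nlinarith [Real.pi_pos]
  obtain ⟨m, hm⟩ := hq
  by_cases h : 2 * j + 1 ≤ q
  · exact main j h
  · have := main (q - j) (by omega)
    rwa [Nat.cast_sub hj.le, show 2 * Real.pi * ((q : ℝ) - j) / q
      = 2 * Real.pi - 2 * Real.pi * j / q by field_simp, Real.cos_two_pi_sub] at this

theorem cos_pi_div_pos (hq : 3 ≤ q) : 0 < Real.cos (Real.pi / q) ∧ Real.cos (Real.pi / q) < 1 := by
  have hq3 : (3 : ℝ) ≤ q := by exact_mod_cast hq
  have hpi := Real.pi_pos
  have h1 : 0 < Real.pi / q := by positivity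
  have h2 : Real.pi / q ≤ Real.pi / 3 := by gcongr
  constructor
  · exact Real.cos_pos_of_mem_Ioo ⟨by linarith, by linarith⟩
  · have := Real.cos_lt_cos_of_nonneg_of_le_pi (x := 0) (y := Real.pi / q) le_rfl (by linarith) h1
    simpa using this

/-- The weight is affine in a cosine lying in `[-cos (π / q), 1]`, so only one endpoint matters,
according to the sign of `a`. -/
theorem stepWeight_nonneg [NeZero q] (hq : Odd q) (hq3 : 3 ≤ q) {a : ℝ} (h1 : -1 / 2 ≤ a)
    (h2 : a * (2 * Real.cos (Real.pi / q)) ≤ 1) (ω : ZMod q) : 0 ≤ stepWeight q a ω := by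
  have hc := cos_pi_div_pos hq3
  have hx := neg_cos_le_cos hq ω.val (ZMod.val_lt ω)
  have hx1 := Real.cos_le_one (2 * Real.pi * ω.val / q)
  rw [stepWeight]
  apply div_nonneg _ (Nat.cast_nonneg q)
  rcases le_or_gt 0 a with ha | ha
  · nlinarith
  · nlinarith

theorem stepWeight_zero (a : ℝ) : stepWeight q a 0 = (1 + 2 * a) / q := by
  simp [stepWeight]

end Kernel

/-! ### Multiplication operator on squarefree monomials -/

section Ladder

/-- Multiplication by `∑ r k` in the basis of the squarefree monomials in the `r k`, for numbers
with `(r k)² = C + (1 - C) r k`. -/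
theorem sum_mul_sum_prod {n : ℕ} (C : ℝ) (r : Fin n → ℝ)
    (hr : ∀ k, r k * r k = C + (1 - C) * r k) (b : Finset (Fin n) → ℝ) :
    (∑ k, r k) * ∑ S, b S * ∏ k ∈ S, r k
      = ∑ S, (∑ k ∈ S, (b (S.erase k) + (1 - C) * b S) + ∑ k ∈ Sᶜ, C * b (insert k S))
        * ∏ k ∈ S, r k := by
  classical
  have hk : ∀ k : Fin n, r k * ∑ S, b S * ∏ i ∈ S, r i
      = ∑ S, (if k ∈ S then b (S.erase k) + (1 - C) * b S else C * b (insert k S))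
        * ∏ i ∈ S, r i := by
    intro k
    -- Sets are paired as `S`, `insert k S` with `k ∉ S`; multiplication by `r k` acts within each
    -- pair.
    have hbij : ∀ F : Finset (Fin n) → ℝ, ∑ S with k ∈ S, F S = ∑ S with k ∉ S, F (insert k S) := by
      intro F
      refine Finset.sum_nbij' (fun S => S.erase k) (fun S => insert k S) ?_ ?_ ?_ ?_ ?_
      · simp
      · simp
      · intro S hS; simp at hS; simp [hS]
      · intro S hS; simp at hS; simp [hS]
      · intro S hS; simp at hS; simp [hS]
    rw [Finset.mul_sum, ← Finset.sum_filter_add_sum_filter_not Finset.univ (fun S => k ∈ S),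
      ← Finset.sum_filter_add_sum_filter_not Finset.univ (fun S => k ∈ S)
        (fun S => (if k ∈ S then _ else _) * _), hbij, hbij, ← Finset.sum_add_distrib,
      ← Finset.sum_add_distrib]
    refine Finset.sum_congr rfl fun S hS => ?_
    simp only [Finset.mem_filter, Finset.mem_univ, true_and] at hS
    simp only [hS, Finset.mem_insert, true_or, if_true, if_false,
      Finset.erase_insert hS, Finset.prod_insert hS]
    linear_combination (b (insert k S) * ∏ i ∈ S, r i) * hr k
  rw [Finset.sum_mul]
  simp_rw [hk]
  rw [Finset.sum_comm]
  refine Finset.sum_congr rfl fun S _ => ?_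
  rw [← Finset.sum_mul, ← Finset.sum_add_sum_compl S]
  congr 2
  · exact Finset.sum_congr rfl fun k hk => by simp [hk]
  · exact Finset.sum_congr rfl fun k hk => by simp [Finset.mem_compl.mp hk]

end Ladder

end Typewriter

namespace Typewriter

/-! ### The linear program with real alphabet size -/

section LinearProgram

variable {q n : ℕ} {ι : Type*} [Fintype ι]

/-- The nontrivial eigenfunction of the two-class scheme with parameter `C`. -/
noncomputable def rho (C : ℝ) {q : ℕ} (z : ZMod q) : ℝ := if z = 0 then 1 else -C

theorem rho_mul_self (C : ℝ) (z : ZMod q) : rho C z * rho C z = C + (1 - C) * rho C z := by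
  unfold rho; split_ifs <;> ring

/-- `rho` is constant on `±1`, so the family of step kernels is stable under it. This keeps all the
product kernels explicit. -/
theorem stepKernel_mul_rho (C a : ℝ) (z : ZMod q) :
    stepKernel q a z * rho C z = stepKernel q (a * -C) z := by
  unfold stepKernel rho; split_ifs <;> simp

theorem sum_rho (C : ℝ) (x y : Fin n → ZMod q) :
    ∑ k, rho C (x k - y k) = n - (1 + C) * hammingDist x y := by
  have : ∀ k, rho C (x k - y k) = 1 - (1 + C) * (if x k ≠ y k then 1 else 0) := by
    intro k
    by_cases h : x k = y k
    · simp [rho, h]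
    · simp [rho, h, sub_eq_zero]
  simp_rw [this]
  rw [Finset.sum_sub_distrib, ← Finset.mul_sum, Finset.sum_boole, hammingDist]
  simp

/-- The product kernel attached to a pair of sets of coordinates. -/
theorem prod_stepKernel_mul (C a : ℝ) (S T : Finset (Fin n)) (z : Fin n → ZMod q) :
    (∏ k, stepKernel q a (z k)) * ((∏ k ∈ S, rho C (z k)) * ∏ k ∈ T, rho C (z k))
      = ∏ k, stepKernel q ((a * if k ∈ S then -C else 1) * if k ∈ T then -C else 1) (z k) := by
  classical
  have e : ∀ S : Finset (Fin n), ∏ k ∈ S, rho C (z k) = ∏ k, if k ∈ S then rho C (z k) else 1 := by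
    intro S; simp
  rw [e S, e T, ← Finset.prod_mul_distrib, ← Finset.prod_mul_distrib]
  refine Finset.prod_congr rfl fun k _ => ?_
  by_cases h1 : k ∈ S <;> by_cases h2 : k ∈ T <;> simp only [h1, h2, if_true, if_false, mul_one,
    one_mul, ← stepKernel_mul_rho]; ring

/-- The orthogonality relation behind the bound. Each coordinate carries parameter `1 / (2C)`, `-1 /
2` or `C / 2`, according as it lies in neither, one or both of `S`, `T`; all three keep the Fourier
weights nonnegative. For `S ≠ T` nonnegativity is enough. -/
theorem sum_pairs_ge [NeZero q] (hq : Odd q) (hq3 : 3 ≤ q) (c : ι → Fin n → ZMod q)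
    (S T : Finset (Fin n)) :
    (if S = T then ((1 + Real.cos (Real.pi / q)) / (Real.cos (Real.pi / q) * q)) ^ n
        * Real.cos (Real.pi / q) ^ S.card else 0) * (Fintype.card ι : ℝ) ^ 2
      ≤ ∑ i, ∑ j, (∏ k, stepKernel q (1 / (2 * Real.cos (Real.pi / q))) (c i k - c j k))
        * ((∏ k ∈ S, rho (Real.cos (Real.pi / q)) (c i k - c j k))
          * ∏ k ∈ T, rho (Real.cos (Real.pi / q)) (c i k - c j k)) := by
  obtain ⟨hC0, hC1⟩ := cos_pi_div_pos hq3
  have hq0 : (0 : ℝ) < q := by exact_mod_cast Nat.pos_of_ne_zero (NeZero.ne q)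
  set C := Real.cos (Real.pi / q) with hC
  set a : Fin n → ℝ := fun k =>
    (1 / (2 * C) * if k ∈ S then -C else 1) * if k ∈ T then -C else 1 with ha
  have hrange : ∀ k, -1 / 2 ≤ a k ∧ a k * (2 * C) ≤ 1 := by
    intro k
    have e1 : 1 / (2 * C) * -C = -1 / 2 := by field_simp
    have e2 : 1 / (2 * C) * (2 * C) = 1 := by field_simp
    have e3 : 0 < 1 / (2 * C) := by positivity
    simp only [ha]
    split_ifs
    · rw [e1]; constructor <;> nlinarith
    · rw [e1]; constructor <;> nlinarith
    · rw [mul_one, e1]; constructor <;> nlinarith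
    · rw [mul_one, mul_one, e2]; constructor <;> linarith
  have hw : ∀ k ω, 0 ≤ stepWeight q (a k) ω := fun k ω =>
    stepWeight_nonneg hq hq3 (hrange k).1 (hrange k).2 ω
  have main := sum_prod_kernel_ge (fun k => stepWeight q (a k)) (fun k => stepKernel q (a k)) hw
    (fun k z => stepKernel_eq hq3 (a k) z) c
  simp_rw [prod_stepKernel_mul]
  refine le_trans (mul_le_mul_of_nonneg_right ?_ (sq_nonneg _)) main
  split_ifs with h
  · subst h
    refine le_of_eq ?_
    have : ∀ k, stepWeight q (a k) 0 = (1 + C) / (C * q) * if k ∈ S then C else 1 := by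
      intro k
      rw [stepWeight_zero]
      simp only [ha]
      split_ifs <;> field_simp
      ring
    simp_rw [this]
    rw [Finset.prod_mul_distrib, Finset.prod_const, Finset.prod_ite_mem]
    simp
  · exact Finset.prod_nonneg fun k _ => hw _ _

/-- The linear programming bound, for a nonnegative approximate eigenvector `b` supported
on `V`. -/
theorem card_mul_le [NeZero q] (hq : Odd q) (hq3 : 3 ≤ q) (c : ι → Fin n → ZMod q)
    (b : Finset (Fin n) → ℝ) (hb : ∀ S, 0 ≤ b S) (hb0 : ∃ S, 0 < b S)
    (V : Finset (Finset (Fin n))) (hV : ∀ S ∉ V, b S = 0) {C lam ε : ℝ}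
    (hC : C = Real.cos (Real.pi / q)) (hε : 0 < ε) (hlam : lam ≤ n)
    (hA : ∀ S, (lam + ε) * b S
      ≤ ∑ k ∈ S, (b (S.erase k) + (1 - C) * b S) + ∑ k ∈ Sᶜ, C * b (insert k S))
    (hc : ∀ i j, i ≠ j → (∀ k, c i k - c j k = 0 ∨ c i k - c j k = 1 ∨ c i k - c j k = -1) →
      n - (1 + C) * hammingDist (c i) (c j) ≤ lam) :
    ε * ((1 + C) / (C * q)) ^ n * Fintype.card ι ≤ (n - lam) * ∑ S ∈ V, C⁻¹ ^ S.card := by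
  classical
  have hq0 : (0 : ℝ) < q := by exact_mod_cast Nat.pos_of_ne_zero (NeZero.ne q)
  have hC0 : 0 < C := hC ▸ (cos_pi_div_pos hq3).1
  set M : ℝ := (Fintype.card ι : ℝ) with hM
  -- These are the coefficients of `(∑ ρ - lam) φ`; they dominate `ε b`.
  set e : Finset (Fin n) → ℝ := fun S =>
    ∑ k ∈ S, (b (S.erase k) + (1 - C) * b S) + ∑ k ∈ Sᶜ, C * b (insert k S) - lam * b S with he
  have heb : ∀ S, ε * b S ≤ e S := fun S => by have := hA S; simp only [he]; linarith
  have he0 : ∀ S, 0 ≤ e S := fun S => (mul_nonneg hε.le (hb S)).trans (heb S)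
  set G : (Fin n → ZMod q) → ℝ := fun z => ∏ k, stepKernel q (1 / (2 * C)) (z k) with hG
  set P : Finset (Fin n) → (Fin n → ZMod q) → ℝ := fun S z => ∏ k ∈ S, rho C (z k) with hP
  set φ : (Fin n → ZMod q) → ℝ := fun z => ∑ S, b S * P S z with hφ
  set f : (Fin n → ZMod q) → ℝ := fun z => G z * (((∑ k, rho C (z k)) - lam) * φ z) * φ z with hf
  have hexp : ∀ z, f z = ∑ S, ∑ T, e S * b T * (G z * (P S z * P T z)) := by
    intro z
    have h1 : ((∑ k, rho C (z k)) - lam) * φ z = ∑ S, e S * P S z := by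
      rw [sub_mul, hφ]
      simp only [hP]
      rw [sum_mul_sum_prod C (fun k => rho C (z k)) (fun k => rho_mul_self C (z k)), Finset.mul_sum,
        ← Finset.sum_sub_distrib]
      refine Finset.sum_congr rfl fun S _ => ?_
      simp only [he]; ring
    simp only [hf]
    rw [h1, hφ, mul_assoc, Finset.sum_mul_sum, Finset.mul_sum]
    refine Finset.sum_congr rfl fun S _ => ?_
    rw [Finset.mul_sum]
    refine Finset.sum_congr rfl fun T _ => ?_
    ring
  set κ : ℝ := ((1 + C) / (C * q)) ^ n with hκ
  set N : ℝ := ∑ S, b S ^ 2 * C ^ S.card with hN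
  have hNpos : 0 < N := by
    obtain ⟨S, hS⟩ := hb0
    exact Finset.sum_pos' (fun S _ => by positivity) ⟨S, Finset.mem_univ S, by positivity⟩
  -- All the coefficients `e S * b T` are nonnegative, so the pair sums may be replaced by their
  -- lower bounds, and only `S = T` survives.
  have hlow : ε * κ * N * M ^ 2 ≤ ∑ i, ∑ j, f (c i - c j) := by
    have hswap : ∑ i, ∑ j, f (c i - c j)
        = ∑ S, ∑ T, e S * b T * ∑ i, ∑ j, G (c i - c j) * (P S (c i - c j) * P T (c i - c j)) := by
      simp_rw [hexp, Finset.mul_sum]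
      rw [Finset.sum_congr rfl fun i _ => Finset.sum_comm, Finset.sum_comm]
      refine Finset.sum_congr rfl fun S _ => ?_
      rw [Finset.sum_congr rfl fun i _ => Finset.sum_comm, Finset.sum_comm]
    rw [hswap]
    have hpair : ∀ S T, (if S = T then κ * C ^ S.card else 0) * M ^ 2
        ≤ ∑ i, ∑ j, G (c i - c j) * (P S (c i - c j) * P T (c i - c j)) := by
      intro S T
      have := sum_pairs_ge hq hq3 c S T
      rw [← hC] at this
      exact this
    calc ε * κ * N * M ^ 2 = ∑ S, (ε * b S) * b S * ((κ * C ^ S.card) * M ^ 2) := by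
          rw [hN, Finset.mul_sum, Finset.sum_mul]
          exact Finset.sum_congr rfl fun S _ => by ring
      _ ≤ ∑ S, e S * b S * ((κ * C ^ S.card) * M ^ 2) := by
          refine Finset.sum_le_sum fun S _ => ?_
          have := heb S
          have := hb S
          gcongr
      _ = ∑ S, ∑ T, e S * b T * ((if S = T then κ * C ^ S.card else 0) * M ^ 2) := by
          refine Finset.sum_congr rfl fun S _ => ?_
          rw [Finset.sum_eq_single S]
          · simp
          · intro T _ hT; simp [hT.symm]
          · simp
      _ ≤ _ := by
          refine Finset.sum_le_sum fun S _ => Finset.sum_le_sum fun T _ => ?_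
          exact mul_le_mul_of_nonneg_left (hpair S T) (mul_nonneg (he0 S) (hb T))
  have hdiag : f 0 = (n - lam) * (∑ S, b S) ^ 2 := by
    simp [hf, hG, hφ, hP, stepKernel, rho]; ring
  -- Confusable pairs are far apart, which makes `∑ ρ - lam` nonpositive; on the other pairs `G`
  -- vanishes.
  have hoff : ∀ i j, i ≠ j → f (c i - c j) ≤ 0 := by
    intro i j hij
    have hf' : f (c i - c j) = G (c i - c j) * (φ (c i - c j)) ^ 2
        * ((∑ k, rho C ((c i - c j) k)) - lam) := by simp only [hf]; ring
    by_cases h : ∀ k, c i k - c j k = 0 ∨ c i k - c j k = 1 ∨ c i k - c j k = -1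
    · rw [hf']
      refine mul_nonpos_of_nonneg_of_nonpos (mul_nonneg (Finset.prod_nonneg fun k _ => ?_)
        (sq_nonneg _)) ?_
      · unfold stepKernel; split_ifs <;> positivity
      · have := sum_rho C (c i) (c j)
        have h2 := hc i j hij h
        simp only [Pi.sub_apply]
        linarith
    · push Not at h
      obtain ⟨k, hk0, hk1, hk2⟩ := h
      have : G (c i - c j) = 0 :=
        Finset.prod_eq_zero (Finset.mem_univ k) (by simp [stepKernel, hk0, hk1, hk2])
      rw [hf', this]; simp
  have hup : ∑ i, ∑ j, f (c i - c j) ≤ M * ((n - lam) * (∑ S, b S) ^ 2) := by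
    calc ∑ i, ∑ j, f (c i - c j) ≤ ∑ _i : ι, (n - lam) * (∑ S, b S) ^ 2 := by
          refine Finset.sum_le_sum fun i _ => ?_
          rw [← Finset.add_sum_erase _ _ (Finset.mem_univ i), sub_self, hdiag]
          have : ∑ j ∈ Finset.univ.erase i, f (c i - c j) ≤ 0 :=
            Finset.sum_nonpos fun j hj => hoff i j (Finset.ne_of_mem_erase hj).symm
          linarith
      _ = _ := by simp [hM]
  -- Cauchy–Schwarz on the support `V`, with weights `C⁻¹ ^ |S|` and `C ^ |S|`. The norm `N` then
  -- cancels against the lower bound.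
  have hcs : (∑ S, b S) ^ 2 ≤ (∑ S ∈ V, C⁻¹ ^ S.card) * N := by
    have h1 : ∑ S, b S = ∑ S ∈ V, b S :=
      (Finset.sum_subset (Finset.subset_univ V) fun S _ hS => hV S hS).symm
    rw [h1]
    refine (Finset.sum_sq_le_sum_mul_sum_of_sq_le_mul V (f := fun S => C⁻¹ ^ S.card)
      (g := fun S => b S ^ 2 * C ^ S.card) (fun S _ => by positivity) (fun S _ => by positivity)
      (fun S _ => ?_)).trans ?_
    · refine le_of_eq ?_; rw [inv_pow]; field_simp
    · refine mul_le_mul_of_nonneg_left ?_ (Finset.sum_nonneg fun S _ => by positivity)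
      exact Finset.sum_le_sum_of_subset_of_nonneg (Finset.subset_univ V)
        fun S _ _ => by positivity
  rcases eq_or_lt_of_le (show 0 ≤ M from Nat.cast_nonneg _) with h0 | hMpos
  · rw [← h0, mul_zero]
    exact mul_nonneg (sub_nonneg.mpr hlam) (Finset.sum_nonneg fun S _ => by positivity)
  · have hfin : (ε * κ * M) * (N * M) ≤ ((n - lam) * ∑ S ∈ V, C⁻¹ ^ S.card) * (N * M) := by
      calc (ε * κ * M) * (N * M) = ε * κ * N * M ^ 2 := by ring
        _ ≤ M * ((n - lam) * (∑ S, b S) ^ 2) := hlow.trans hup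
        _ ≤ M * ((n - lam) * ((∑ S ∈ V, C⁻¹ ^ S.card) * N)) :=
            mul_le_mul_of_nonneg_left (mul_le_mul_of_nonneg_left hcs (sub_nonneg.mpr hlam)) hMpos.le
        _ = _ := by ring
    exact le_of_mul_le_mul_right hfin (mul_pos hNpos hMpos)

end LinearProgram

end Typewriter

namespace Typewriter

/-! ### Approximate eigenvectors and ball volumes -/

section Window

/-- A sine wave on the window `[a, a + m]`, with a geometric factor. -/
noncomputable def window (θ : ℝ) (a m s : ℕ) : ℝ :=
  if a ≤ s ∧ s ≤ a + m then θ ^ s * Real.sin (Real.pi * (s - a + 1) / (m + 2)) else 0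

theorem window_nonneg {θ : ℝ} (hθ : 0 ≤ θ) (a m s : ℕ) : 0 ≤ window θ a m s := by
  unfold window
  split_ifs with h
  · have h1 : (a : ℝ) ≤ s := by exact_mod_cast h.1
    have h2 : (s : ℝ) ≤ a + m := by exact_mod_cast h.2
    refine mul_nonneg (by positivity) (Real.sin_nonneg_of_nonneg_of_le_pi ?_ ?_)
    · have := Real.pi_pos
      apply div_nonneg _ (by positivity)
      apply mul_nonneg this.le; linarith
    · rw [div_le_iff₀ (by positivity)]
      exact mul_le_mul_of_nonneg_left (by linarith) Real.pi_pos.le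
  · exact le_rfl

theorem window_pos {θ : ℝ} (hθ : 0 < θ) (a m : ℕ) : 0 < window θ a m a := by
  have hm : (0 : ℝ) < m + 2 := by positivity
  have := Real.pi_pos
  simp only [window, le_refl, Nat.le_add_right, and_self, if_true, sub_self, zero_add, mul_one]
  refine mul_pos (by positivity) (Real.sin_pos_of_pos_of_lt_pi (by positivity) ?_)
  rw [div_lt_iff₀ hm]
  nlinarith [Nat.cast_nonneg (α := ℝ) m]

/-- The sine vanishes one step outside the window on either side, so the formula extends there and
the recurrence needs no boundary correction. -/
theorem window_eq (θ : ℝ) {a m s : ℕ} (h1 : a ≤ s + 1) (h2 : s ≤ a + m + 1) :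
    window θ a m s = θ ^ s * Real.sin (Real.pi * (s - a + 1) / (m + 2)) := by
  have hm : (m + 2 : ℝ) ≠ 0 := by positivity
  unfold window
  split_ifs with h
  · rfl
  · rcases (by omega : a = s + 1 ∨ s = a + m + 1) with h | h
    · subst h; simp
    · subst h
      rw [show Real.pi * (((a + m + 1 : ℕ) : ℝ) - a + 1) / (m + 2) = Real.pi by
        push_cast; field_simp; ring]
      simp

/-- On the window the coefficients `s` and `n - s` are at least `a` and `n - a - m`. With these
constants, `θ` makes the two neighbour terms symmetric, and `sin (x - h) + sin (x + h) = 2 sin x cos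
h` gives an exact eigenvector. -/
theorem window_eigen {C θ p : ℝ} (hC0 : 0 < C) (hC1 : C < 1) (hθ : 0 < θ) {n a m : ℕ}
    (ha : 1 ≤ a) (hp1 : (a : ℝ) = p * θ) (hp2 : (n - a - m : ℝ) * C * θ = p)
    {s : ℕ} (hs : s ≤ n) :
    (2 * p * Real.cos (Real.pi / (m + 2)) + (1 - C) * a) * window θ a m s
      ≤ s * (window θ a m (s - 1) + (1 - C) * window θ a m s)
        + (n - s) * (C * window θ a m (s + 1)) := by
  have w0 := window_nonneg hθ.le a m s
  have w1 := window_nonneg hθ.le a m (s - 1)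
  have w2 := window_nonneg hθ.le a m (s + 1)
  have hs' : (s : ℝ) ≤ n := by exact_mod_cast hs
  by_cases h : a ≤ s ∧ s ≤ a + m
  · obtain ⟨t, rfl⟩ : ∃ t, s = t + 1 := ⟨s - 1, by omega⟩
    have h1 : (a : ℝ) ≤ (t + 1 : ℕ) := by exact_mod_cast h.1
    have h2 : ((t + 1 : ℕ) : ℝ) ≤ a + m := by exact_mod_cast h.2
    have e0 := window_eq θ (a := a) (m := m) (s := t + 1) (by omega) (by omega)
    have e1 := window_eq θ (a := a) (m := m) (s := t) (by omega) (by omega)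
    have e2 := window_eq θ (a := a) (m := m) (s := t + 1 + 1) (by omega) (by omega)
    set x := Real.pi * (((t + 1 : ℕ) : ℝ) - a + 1) / (m + 2) with hx
    set h := Real.pi / ((m : ℝ) + 2) with hh
    have x1 : Real.pi * ((t : ℝ) - a + 1) / (m + 2) = x - h := by
      rw [hx, hh]; push_cast; ring
    have x2 : Real.pi * (((t + 1 + 1 : ℕ) : ℝ) - a + 1) / (m + 2) = x + h := by
      rw [hx, hh]; push_cast; ring
    rw [x1] at e1
    rw [x2] at e2
    have key : (a : ℝ) * window θ a m t + (n - a - m) * C * window θ a m (t + 1 + 1)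
        = 2 * p * Real.cos h * window θ a m (t + 1) := by
      rw [e0, e1, e2, hp1, Real.sin_sub, Real.sin_add]
      have : (n - a - m : ℝ) * C * θ ^ (t + 1 + 1) = p * θ ^ (t + 1) := by
        rw [← hp2]; ring
      rw [← hp1, ← mul_assoc (_ * C), this, hp1]
      ring
    rw [add_tsub_cancel_right] at w1 ⊢
    have i1 : (a : ℝ) * window θ a m t ≤ (t + 1 : ℕ) * window θ a m t :=
      mul_le_mul_of_nonneg_right h1 w1
    have i2 : (n - a - m : ℝ) * (C * window θ a m (t + 1 + 1))
        ≤ (n - (t + 1 : ℕ)) * (C * window θ a m (t + 1 + 1)) :=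
      mul_le_mul_of_nonneg_right (by linarith) (mul_nonneg hC0.le w2)
    have i3 : (a : ℝ) * ((1 - C) * window θ a m (t + 1))
        ≤ (t + 1 : ℕ) * ((1 - C) * window θ a m (t + 1)) :=
      mul_le_mul_of_nonneg_right h1 (mul_nonneg (by linarith) w0)
    linarith
  · rw [show window θ a m s = 0 by simp [window, h]]
    have : 0 ≤ (n - s : ℝ) * (C * window θ a m (s + 1)) :=
      mul_nonneg (by linarith) (mul_nonneg hC0.le w2)
    have : 0 ≤ (s : ℝ) * window θ a m (s - 1) := mul_nonneg (Nat.cast_nonneg s) w1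
    linarith

/-- The linear programming bound for codes whose confusable pairs are at distance at least `d`. -/
theorem card_mul_le_window {q n : ℕ} [NeZero q] {ι : Type*} [Fintype ι] (hq : Odd q) (hq3 : 3 ≤ q)
    (c : ι → Fin n → ZMod q) {C d : ℝ} (hC : C = Real.cos (Real.pi / q)) (hd : 0 ≤ d)
    (hc : ∀ i j, i ≠ j → (∀ k, c i k - c j k = 0 ∨ c i k - c j k = 1 ∨ c i k - c j k = -1) →
      d ≤ hammingDist (c i) (c j))
    {a m : ℕ} (ha : 1 ≤ a) (hn : a + m < n)
    (hε : 0 < 2 * √(a * (n - a - m) * C) * Real.cos (Real.pi / (m + 2)) + (1 - C) * a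
      - (n - (1 + C) * d)) :
    (2 * √(a * (n - a - m) * C) * Real.cos (Real.pi / (m + 2)) + (1 - C) * a
      - (n - (1 + C) * d)) * ((1 + C) / (C * q)) ^ n * Fintype.card ι
      ≤ (1 + C) * d * ∑ S : Finset (Fin n) with S.card ≤ a + m, C⁻¹ ^ S.card := by
  classical
  have hC0 : 0 < C := hC ▸ (cos_pi_div_pos hq3).1
  have hC1 : C < 1 := hC ▸ (cos_pi_div_pos hq3).2
  have ha' : (0 : ℝ) < a := by exact_mod_cast ha
  have hN : (0 : ℝ) < n - a - m := by
    have : ((a + m : ℕ) : ℝ) < n := by exact_mod_cast hn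
    push_cast at this; linarith
  set p := √(a * (n - a - m) * C) with hp
  have hp0 : 0 < p := Real.sqrt_pos.mpr (by positivity)
  have hpp : p * p = a * (n - a - m) * C := Real.mul_self_sqrt (by positivity)
  have hθ : 0 < a / p := by positivity
  have hp1 : (a : ℝ) = p * (a / p) := by field_simp
  have hp2 : (n - a - m : ℝ) * C * (a / p) = p := by field_simp; linarith
  have := card_mul_le hq hq3 c (fun S => window (a / p) a m S.card)
    (fun S => window_nonneg hθ.le _ _ _)
    (by
      obtain ⟨S, hS⟩ := Finset.exists_subset_card_eq
        (s := (Finset.univ : Finset (Fin n))) (n := a) (by simp; omega)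
      exact ⟨S, by simpa [hS.2] using window_pos hθ a m⟩)
    (Finset.univ.filter fun S : Finset (Fin n) => S.card ≤ a + m)
    (fun S hS => by simp at hS; simp [window]; omega)
    (lam := n - (1 + C) * d) hC hε (by nlinarith)
    (fun S => by
      have hs : S.card ≤ n := by simpa using Finset.card_le_univ S
      have := window_eigen hC0 hC1 hθ ha hp1 hp2 hs
      have e1 : ∑ k ∈ S, (window (a / p) a m (S.erase k).card + (1 - C) * window (a / p) a m S.card)
          = S.card * (window (a / p) a m (S.card - 1) + (1 - C) * window (a / p) a m S.card) := by
        rw [Finset.sum_congr rfl fun k hk => by rw [Finset.card_erase_of_mem hk],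
          Finset.sum_const, nsmul_eq_mul]
      have e2 : ∑ k ∈ Sᶜ, C * window (a / p) a m (insert k S).card
          = (n - S.card) * (C * window (a / p) a m (S.card + 1)) := by
        rw [Finset.sum_congr rfl fun k hk => by
          rw [Finset.card_insert_of_notMem (Finset.mem_compl.mp hk)],
          Finset.sum_const, nsmul_eq_mul, Finset.card_compl, Fintype.card_fin, Nat.cast_sub hs]
      rw [e1, e2]
      refine le_trans (le_of_eq ?_) this
      ring)
    (fun i j hij h => by
      have := hc i j hij h
      nlinarith)
  simpa using this

/-- The volume of a Hamming ball in terms of the entropy function. -/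
theorem sum_ball_le {n : ℕ} {Q τ r : ℝ} (hQ : 1 < Q) (h0 : 0 < τ) (h1 : τ ≤ 1 - 1 / Q)
    (hr : r ≤ τ * n) :
    ∑ S : Finset (Fin n) with (S.card : ℝ) ≤ r, (Q - 1) ^ S.card
      ≤ (2 : ℝ) ^ ((n : ℝ) * entropy Q τ) := by
  set u := Q - 1 with hu
  have hu0 : 0 < u := by linarith
  have hτ1 : τ < 1 := h1.trans_lt (by have : 0 < 1 / Q := by positivity
                                      linarith)
  have h1τ : 0 < 1 - τ := by linarith
  -- The optimal Chernoff tilt; `z ≤ 1` is exactly `τ ≤ 1 - 1 / Q`.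
  set z := τ / ((1 - τ) * u) with hz
  have hz0 : 0 < z := by positivity
  have hz1 : z ≤ 1 := by
    rw [hz, div_le_one (by positivity)]
    have : τ * Q ≤ (1 - 1 / Q) * Q := mul_le_mul_of_nonneg_right h1 (by linarith)
    rw [sub_mul, div_mul_cancel₀ _ (by linarith)] at this
    rw [hu]; linarith
  have hbase : z ^ (-τ) * (u * z + 1) = (2 : ℝ) ^ entropy Q τ := by
    have e1 : u * z + 1 = Real.exp (-Real.log (1 - τ)) := by
      rw [Real.exp_neg, Real.exp_log h1τ, hz]; field_simp; ring
    rw [e1, Real.rpow_def_of_pos hz0, Real.rpow_def_of_pos two_pos, ← Real.exp_add, hz,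
      Real.log_div h0.ne' (by positivity), Real.log_mul h1τ.ne' hu0.ne', entropy]
    have := Real.log_pos one_lt_two
    simp only [Real.logb, ← hu]
    congr 1
    field_simp
    ring
  have hz' : ∀ S : Finset (Fin n), (S.card : ℝ) ≤ r →
      u ^ S.card ≤ z ^ (-(τ * n)) * (u * z) ^ S.card := by
    intro S hS
    have h2 : 1 ≤ z ^ ((S.card : ℝ) - τ * n) :=
      Real.one_le_rpow_of_pos_of_le_one_of_nonpos hz0 hz1 (by linarith)
    rw [sub_eq_neg_add, Real.rpow_add hz0, Real.rpow_natCast] at h2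
    calc u ^ S.card ≤ u ^ S.card * (z ^ (-(τ * n)) * z ^ S.card) :=
          le_mul_of_one_le_right (by positivity) h2
      _ = _ := by rw [mul_pow]; ring
  calc ∑ S : Finset (Fin n) with (S.card : ℝ) ≤ r, u ^ S.card
      ≤ ∑ S : Finset (Fin n) with (S.card : ℝ) ≤ r, z ^ (-(τ * n)) * (u * z) ^ S.card :=
        Finset.sum_le_sum fun S hS => hz' S (by simpa using hS)
    _ ≤ ∑ S : Finset (Fin n), z ^ (-(τ * n)) * (u * z) ^ S.card :=
        Finset.sum_le_sum_of_subset_of_nonneg (Finset.filter_subset _ _) fun S _ _ => by positivity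
    _ = z ^ (-(τ * n)) * (u * z + 1) ^ n := by
        rw [← Finset.mul_sum]
        have := Fintype.sum_pow_mul_eq_add_pow (Fin n) (u * z) 1
        simp only [one_pow, mul_one, Fintype.card_fin] at this
        rw [this]
    _ = (2 : ℝ) ^ ((n : ℝ) * entropy Q τ) := by
        rw [mul_comm (n : ℝ), Real.rpow_mul zero_le_two, Real.rpow_natCast, ← hbase, mul_pow,
          ← neg_mul, Real.rpow_mul hz0.le, Real.rpow_natCast]

end Window

end Typewriter

namespace Typewriter

/-! ### Error probability of confusable codewords -/

section Channel

variable {q n M : ℕ}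

theorem Wn_nonneg (y x : Fin n → ZMod q) : 0 ≤ Wn y x :=
  Finset.prod_nonneg fun k _ => by unfold W; split_ifs <;> norm_num

theorem Code.dec_le_one (c : Code q n M) (y : Fin n → ZMod q) (m : Fin M) : c.dec y m ≤ 1 :=
  c.dec_sum y ▸ Finset.single_le_sum (fun i _ => c.dec_nonneg y i) (Finset.mem_univ m)

variable [NeZero q]

theorem Code.err_nonneg (c : Code q n M) (m : Fin M) : 0 ≤ c.err m :=
  Finset.sum_nonneg fun y _ => mul_nonneg (Wn_nonneg _ _) (by linarith [c.dec_le_one y m])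

/-- Two inputs that can be confused have a common output letter. -/
theorem half_pow_le_sum_min (hq3 : 3 ≤ q) (x x' : ZMod q)
    (h : x - x' = 0 ∨ x - x' = 1 ∨ x - x' = -1) :
    (1 / 2 : ℝ) ^ (if x ≠ x' then 1 else 0) ≤ ∑ y, min (W y x) (W y x') := by
  obtain ⟨h1, -⟩ := ne_of_three_le hq3
  have hnn : ∀ y ∈ Finset.univ, 0 ≤ min (W y x) (W y x') := fun y _ =>
    le_min (by unfold W; split_ifs <;> norm_num) (by unfold W; split_ifs <;> norm_num)
  rcases h with h | h | h
  · obtain rfl : x = x' := sub_eq_zero.mp h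
    have hne : x ≠ x + 1 := fun h => h1 (by simpa using h.symm)
    have := Finset.sum_le_sum_of_subset_of_nonneg (Finset.subset_univ {x, x + 1})
      (f := fun y => min (W y x) (W y x)) (fun y hy _ => hnn y hy)
    refine le_trans (le_of_eq ?_) this
    rw [Finset.sum_pair hne]
    simp [W]
    norm_num
  · obtain rfl : x = x' + 1 := by linear_combination h
    refine le_trans (le_of_eq ?_) (Finset.single_le_sum hnn (Finset.mem_univ (x' + 1)))
    simp [W, h1]
  · obtain rfl : x' = x + 1 := by linear_combination -h
    refine le_trans (le_of_eq ?_) (Finset.single_le_sum hnn (Finset.mem_univ (x + 1)))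
    simp [W, h1]

/-- The error probabilities of two confusable codewords at Hamming distance `d` add up to at
least `2 ^ (-d)`. -/
theorem Code.half_pow_le_err_add_err (hq3 : 3 ≤ q) (c : Code q n M) {m m' : Fin M} (hm : m ≠ m')
    (h : ∀ k, c.enc m k - c.enc m' k = 0 ∨ c.enc m k - c.enc m' k = 1
      ∨ c.enc m k - c.enc m' k = -1) :
    (1 / 2 : ℝ) ^ hammingDist (c.enc m) (c.enc m') ≤ c.err m + c.err m' := by
  classical
  have hnn : ∀ y x : ZMod q, 0 ≤ W y x := fun y x => by unfold W; split_ifs <;> norm_num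
  calc (1 / 2 : ℝ) ^ hammingDist (c.enc m) (c.enc m')
      = ∏ k, (1 / 2 : ℝ) ^ (if c.enc m k ≠ c.enc m' k then 1 else 0) := by
        rw [Finset.prod_pow_eq_pow_sum, hammingDist, Finset.card_filter]
    _ ≤ ∏ k, ∑ y, min (W y (c.enc m k)) (W y (c.enc m' k)) :=
        Finset.prod_le_prod (fun k _ => by positivity)
          fun k _ => half_pow_le_sum_min hq3 _ _ (h k)
    _ = ∑ y : Fin n → ZMod q, ∏ k, min (W (y k) (c.enc m k)) (W (y k) (c.enc m' k)) := by
        rw [Finset.prod_univ_sum, Fintype.piFinset_univ]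
    _ ≤ ∑ y : Fin n → ZMod q, (Wn y (c.enc m) * (1 - c.dec y m)
          + Wn y (c.enc m') * (1 - c.dec y m')) := by
        refine Finset.sum_le_sum fun y _ => ?_
        -- `t` lies below both likelihoods, and the two probabilities of not deciding `m`,
        -- respectively `m'`, add up to at least `1`.
        set t := ∏ k, min (W (y k) (c.enc m k)) (W (y k) (c.enc m' k)) with ht
        have t0 : 0 ≤ t := Finset.prod_nonneg fun k _ => le_min (hnn _ _) (hnn _ _)
        have t1 : t ≤ Wn y (c.enc m) := Finset.prod_le_prod
          (fun k _ => le_min (hnn _ _) (hnn _ _)) fun k _ => min_le_left _ _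
        have t2 : t ≤ Wn y (c.enc m') := Finset.prod_le_prod
          (fun k _ => le_min (hnn _ _) (hnn _ _)) fun k _ => min_le_right _ _
        have hsum : c.dec y m + c.dec y m' ≤ 1 := by
          rw [← c.dec_sum y, ← Finset.sum_pair hm]
          exact Finset.sum_le_sum_of_subset_of_nonneg (Finset.subset_univ _)
            fun i _ _ => c.dec_nonneg y i
        have d1 := c.dec_le_one y m
        have d2 := c.dec_le_one y m'
        have i1 := mul_le_mul_of_nonneg_right t1 (sub_nonneg.mpr d1)
        have i2 := mul_le_mul_of_nonneg_right t2 (sub_nonneg.mpr d2)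
        nlinarith
    _ = c.err m + c.err m' := by rw [Finset.sum_add_distrib]; rfl

theorem Code.avgErr_le_maxErr (c : Code q n M) (hM : 0 < M) : c.avgErr ≤ c.maxErr := by
  have hM' : (0 : ℝ) < M := by exact_mod_cast hM
  rw [Code.avgErr, div_le_iff₀ hM']
  calc ∑ m, c.err m ≤ ∑ _m : Fin M, c.maxErr :=
        Finset.sum_le_sum fun m _ => le_ciSup (f := c.err) (Set.finite_range _).bddAbove m
    _ = c.maxErr * M := by simp [mul_comm]

/-- If every subfamily with at least half of the codewords contains a confusable pair at distance
less than `d`, then the average error probability is at least `2 ^ (-d) / 4`. -/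
theorem Code.rpow_le_avgErr (hq3 : 3 ≤ q) (c : Code q n M) (hM : 0 < M) {d : ℝ}
    (h : ∀ A : Finset (Fin M), (M : ℝ) / 2 ≤ A.card → ∃ m ∈ A, ∃ m' ∈ A, m ≠ m' ∧
      (∀ k, c.enc m k - c.enc m' k = 0 ∨ c.enc m k - c.enc m' k = 1
        ∨ c.enc m k - c.enc m' k = -1) ∧ (hammingDist (c.enc m) (c.enc m') : ℝ) < d) :
    (2 : ℝ) ^ (-d) / 4 ≤ c.avgErr := by
  have hM' : (0 : ℝ) < M := by exact_mod_cast hM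
  have havg : ∑ m, c.err m = c.avgErr * M := by rw [Code.avgErr, div_mul_cancel₀ _ hM'.ne']
  have h0 : 0 ≤ c.avgErr := div_nonneg (Finset.sum_nonneg fun m _ => c.err_nonneg m) hM'.le
  -- By Markov's inequality at least half of the codewords have error at most twice the average.
  obtain ⟨m, hm, m', hm', hne, hconf, hd⟩ :=
    h (Finset.univ.filter fun m => c.err m ≤ 2 * c.avgErr) (by
      have hcard : ((Finset.univ.filter fun m => c.err m ≤ 2 * c.avgErr).card : ℝ)
          + (Finset.univ.filter fun m => ¬ c.err m ≤ 2 * c.avgErr).card = M := by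
        have := Finset.card_filter_add_card_filter_not (s := (Finset.univ : Finset (Fin M)))
          (fun m => c.err m ≤ 2 * c.avgErr)
        rw [Finset.card_univ, Fintype.card_fin] at this
        exact_mod_cast this
      set B := Finset.univ.filter fun m => ¬ c.err m ≤ 2 * c.avgErr with hB
      by_contra hlt
      have hBM : (M : ℝ) / 2 < B.card := by linarith
      have hBpos : 0 < B.card := by
        have : (0 : ℝ) < B.card := by linarith [half_pos hM']
        exact_mod_cast this
      have h1 : ∑ m ∈ B, 2 * c.avgErr < ∑ m ∈ B, c.err m :=
        Finset.sum_lt_sum_of_nonempty (Finset.card_pos.mp hBpos) fun m hm => by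
          simpa [hB] using hm
      have h2 : ∑ m ∈ B, c.err m ≤ ∑ m, c.err m :=
        Finset.sum_le_sum_of_subset_of_nonneg (Finset.subset_univ _) fun m _ _ => c.err_nonneg m
      rw [Finset.sum_const, nsmul_eq_mul] at h1
      nlinarith)
  simp only [Finset.mem_filter, Finset.mem_univ, true_and] at hm hm'
  have h1 := c.half_pow_le_err_add_err hq3 hne hconf
  have h2 : (2 : ℝ) ^ (-d) ≤ (1 / 2 : ℝ) ^ hammingDist (c.enc m) (c.enc m') := by
    rw [one_div, inv_pow, ← Real.rpow_natCast, ← Real.rpow_neg zero_le_two]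
    exact Real.rpow_le_rpow_of_exponent_le one_le_two (by linarith)
  linarith

/-- Without a code the infimum defining the optimal error would take a default value and have no
useful lower bound. -/
instance {M : ℕ} [NeZero M] : Nonempty (Code q n M) :=
  ⟨{ enc := fun _ _ => 0
     dec := fun _ m => if m = 0 then 1 else 0
     dec_nonneg := fun _ m => by split_ifs <;> norm_num
     dec_sum := fun _ => by simp }⟩

end Channel

end Typewriter

namespace Typewriter

/-! ### Entropy and the involution of the linear programming bound -/

section Entropy

theorem entropy_eq (Q t : ℝ) :
    entropy Q t = (t * Real.log (Q - 1) + Real.binEntropy t) / Real.log 2 := by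
  simp only [entropy, Real.logb, Real.binEntropy, Real.log_inv]
  ring

theorem entropy_continuous (Q : ℝ) : Continuous (entropy Q) := by
  rw [show entropy Q = fun t => (t * Real.log (Q - 1) + Real.binEntropy t) / Real.log 2 from
    funext (entropy_eq Q)]
  have := Real.binEntropy_continuous
  fun_prop

theorem entropy_strictMonoOn {Q : ℝ} (hQ : 1 < Q) :
    StrictMonoOn (entropy Q) (Icc 0 (1 - 1 / Q)) := by
  refine strictMonoOn_of_deriv_pos (convex_Icc _ _) (entropy_continuous Q).continuousOn ?_
  rw [interior_Icc]
  intro t ht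
  have hQ0 : 0 < 1 / Q := by positivity
  have ht1 : t < 1 := by linarith [ht.2]
  have hder : HasDerivAt (entropy Q)
      ((Real.log (Q - 1) + (Real.log (1 - t) - Real.log t)) / Real.log 2) t := by
    rw [show entropy Q = fun t => (t * Real.log (Q - 1) + Real.binEntropy t) / Real.log 2 from
      funext (entropy_eq Q)]
    have h1 := Real.hasDerivAt_binEntropy ht.1.ne' ht1.ne
    have h2 := (hasDerivAt_id t).mul_const (Real.log (Q - 1))
    simpa using (h2.add h1).div_const (Real.log 2)
  rw [hder.deriv]
  refine div_pos ?_ (Real.log_pos one_lt_two)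
  rw [← add_sub_assoc, sub_pos, ← Real.log_mul (by linarith) (by linarith)]
  refine Real.log_lt_log ht.1 ?_
  have := mul_lt_mul_of_pos_right ht.2 (show 0 < Q by linarith)
  rw [sub_mul, div_mul_cancel₀ _ (by linarith)] at this
  linarith

theorem entropy_zero (Q : ℝ) : entropy Q 0 = 0 := by simp [entropy]

theorem entropy_one_sub_inv {Q : ℝ} (hQ : 1 < Q) : entropy Q (1 - 1 / Q) = Real.logb 2 Q := by
  have h : 1 - 1 / Q = (Q - 1) / Q := by field_simp
  have h' : 1 - (Q - 1) / Q = 1 / Q := by field_simp; ring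
  rw [entropy, h, h', Real.logb_div (by linarith) (by linarith),
    Real.logb_div one_ne_zero (by linarith), Real.logb_one]
  field_simp
  ring

theorem entropy_bijOn {Q : ℝ} (hQ : 1 < Q) :
    BijOn (entropy Q) (Icc 0 (1 - 1 / Q)) (Icc 0 (Real.logb 2 Q)) := by
  have hmono := entropy_strictMonoOn hQ
  have h0 : 0 ≤ 1 - 1 / Q := by
    rw [sub_nonneg, div_le_one (by linarith)]; exact hQ.le
  refine ⟨fun t ht => ⟨?_, ?_⟩, hmono.injOn, ?_⟩
  · rw [← entropy_zero Q]; exact hmono.monotoneOn (left_mem_Icc.mpr h0) ht ht.1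
  · rw [← entropy_one_sub_inv hQ]; exact hmono.monotoneOn ht (right_mem_Icc.mpr h0) ht.2
  · have := intermediate_value_Icc h0 (entropy_continuous Q).continuousOn
    rwa [entropy_zero, entropy_one_sub_inv hQ] at this

/-- The argument of the entropy in the first linear programming bound. -/
noncomputable def flip (Q t : ℝ) : ℝ :=
  ((Q - 1) - (Q - 2) * t - 2 * √((Q - 1) * t * (1 - t))) / Q

/-- The square root of `flip Q t`. -/
noncomputable def flipRoot (Q t : ℝ) : ℝ := (√(Q - 1) * √(1 - t) - √t) / √Q

variable {Q t : ℝ}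

/-- With `t = sin² x` and `1 - 1 / Q = sin² α`, the root is `sin (α - x)`: the map is the reflection
`x ↦ α - x`. -/
theorem flip_eq (hQ : 1 < Q) (h0 : 0 ≤ t) (h1 : t ≤ 1) : flip Q t = flipRoot Q t ^ 2 := by
  have e1 := Real.sq_sqrt (show 0 ≤ Q - 1 by linarith)
  have e2 := Real.sq_sqrt (show 0 ≤ 1 - t by linarith)
  have e3 := Real.sq_sqrt h0
  rw [flip, flipRoot, div_pow, Real.sq_sqrt (by linarith), mul_assoc,
    Real.sqrt_mul (by linarith), Real.sqrt_mul h0]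
  congr 1
  rw [sub_sq, mul_pow, e1, e2, e3]
  ring

theorem le_one_of_mem (hQ : 1 < Q) (ht : t ∈ Icc 0 (1 - 1 / Q)) : t ≤ 1 := by
  have : 0 < 1 / Q := by positivity
  linarith [ht.2]

theorem flipRoot_nonneg (hQ : 1 < Q) (ht : t ∈ Icc 0 (1 - 1 / Q)) : 0 ≤ flipRoot Q t := by
  refine div_nonneg (sub_nonneg.mpr ?_) (Real.sqrt_nonneg _)
  rw [← Real.sqrt_mul (by linarith)]
  refine Real.sqrt_le_sqrt ?_
  have := mul_le_mul_of_nonneg_right ht.2 (show 0 ≤ Q by linarith)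
  rw [sub_mul, div_mul_cancel₀ _ (by linarith)] at this
  linarith

theorem flip_strictAntiOn (hQ : 1 < Q) : StrictAntiOn (flip Q) (Icc 0 (1 - 1 / Q)) := by
  intro s hs t ht hst
  rw [flip_eq hQ hs.1 (le_one_of_mem hQ hs), flip_eq hQ ht.1 (le_one_of_mem hQ ht)]
  refine pow_lt_pow_left₀ ?_ (flipRoot_nonneg hQ ht) two_ne_zero
  have h1 : √s < √t := Real.sqrt_lt_sqrt hs.1 hst
  have h2 : √(1 - t) ≤ √(1 - s) := Real.sqrt_le_sqrt (by linarith)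
  have h3 := mul_le_mul_of_nonneg_left h2 (Real.sqrt_nonneg (Q - 1))
  exact div_lt_div_of_pos_right (by linarith) (Real.sqrt_pos.mpr (by linarith))

theorem flip_mem (hQ : 1 < Q) (ht : t ∈ Icc 0 (1 - 1 / Q)) : flip Q t ∈ Icc 0 (1 - 1 / Q) := by
  have hz : flip Q 0 = 1 - 1 / Q := by simp [flip]; field_simp
  refine ⟨?_, ?_⟩
  · rw [flip_eq hQ ht.1 (le_one_of_mem hQ ht)]; positivity
  · rw [← hz]
    exact (flip_strictAntiOn hQ).antitoneOn ⟨le_rfl, ht.1.trans ht.2⟩ ht ht.1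

/-- A reflection is its own inverse; `r2` below is the formula for `cos (α - x)`. -/
theorem flip_flip (hQ : 1 < Q) (ht : t ∈ Icc 0 (1 - 1 / Q)) : flip Q (flip Q t) = t := by
  have h1 := le_one_of_mem hQ ht
  have hm := flip_mem hQ ht
  have hQ0 : 0 < √Q := Real.sqrt_pos.mpr (by linarith)
  have eQ := Real.sq_sqrt (show 0 ≤ Q by linarith)
  have e1 := Real.sq_sqrt (show 0 ≤ Q - 1 by linarith)
  have e2 := Real.sq_sqrt (show 0 ≤ 1 - t by linarith)
  have e3 := Real.sq_sqrt ht.1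
  have r1 : √(flip Q t) = flipRoot Q t := by
    rw [flip_eq hQ ht.1 h1, Real.sqrt_sq (flipRoot_nonneg hQ ht)]
  have r2 : √(1 - flip Q t) = (√(1 - t) + √(Q - 1) * √t) / √Q := by
    rw [← Real.sqrt_sq (show 0 ≤ (√(1 - t) + √(Q - 1) * √t) / √Q by positivity),
      flip_eq hQ ht.1 h1, flipRoot, div_pow, div_pow, eQ]
    congr 1
    field_simp
    linear_combination (-(√(1 - t) ^ 2) - √t ^ 2) * e1 - Q * e2 - Q * e3
  rw [flip_eq hQ hm.1 (le_one_of_mem hQ hm), flipRoot, r1, r2, flipRoot]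
  rw [show √(Q - 1) * ((√(1 - t) + √(Q - 1) * √t) / √Q) - (√(Q - 1) * √(1 - t) - √t) / √Q
    = (√(Q - 1) ^ 2 + 1) * √t / √Q by ring, e1]
  rw [div_div, div_pow, mul_pow, e3, ← sq, eQ]
  field_simp
  ring

theorem flip_bijOn (hQ : 1 < Q) :
    BijOn (flip Q) (Icc 0 (1 - 1 / Q)) (Icc 0 (1 - 1 / Q)) :=
  ⟨fun _ ht => flip_mem hQ ht, (flip_strictAntiOn hQ).injOn,
    fun t ht => ⟨flip Q t, flip_mem hQ ht, flip_flip hQ ht⟩⟩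

theorem rateLP1_bijOn (hQ : 1 < Q) (r : ℝ) :
    BijOn (rateLP1 r Q) (Icc 0 (1 - 1 / Q)) (Icc r (r + Real.logb 2 Q)) := by
  have h1 := (entropy_bijOn hQ).comp (flip_bijOn hQ)
  have h2 : BijOn (fun x => r + x) (Icc 0 (Real.logb 2 Q)) (Icc r (r + Real.logb 2 Q)) := by
    have := (add_right_injective r).injOn.bijOn_image (s := Icc 0 (Real.logb 2 Q))
    rwa [image_const_add_Icc, add_zero] at this
  exact h2.comp h1

/-- Every relative distance above the inverse function is excluded by a ball of small volume. -/
theorem exists_radius (hQ : 1 < Q) {r R δ : ℝ} (h0 : r < R) (h1 : R ≤ r + Real.logb 2 Q)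
    (hδ : ELP1 r Q R < δ) :
    0 < δ ∧ ∃ τ, 0 < τ ∧ τ < 1 - 1 / Q ∧ flip Q τ < δ ∧ r + entropy Q τ < R := by
  have hR : R ∈ rateLP1 r Q '' Icc 0 (1 - 1 / Q) := by
    rw [(rateLP1_bijOn hQ r).image_eq]; exact ⟨h0.le, h1⟩
  set E := ELP1 r Q R with hE
  have hEm : E ∈ Icc 0 (1 - 1 / Q) := Function.invFunOn_mem hR
  have hER : r + entropy Q (flip Q E) = R := Function.invFunOn_eq hR
  have hpos : 0 ≤ 1 - 1 / Q := hEm.1.trans hEm.2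
  have hlast : flip Q (1 - 1 / Q) = 0 := by
    rw [← flip_flip hQ (left_mem_Icc.mpr hpos)]
    congr 1
    simp [flip]; field_simp
  have hlt : E < 1 - 1 / Q := by
    refine lt_of_le_of_ne hEm.2 fun h => ?_
    rw [h, hlast, entropy_zero] at hER
    linarith
  -- The radius is `τ = flip Q δ'` for a distance `δ'` strictly between `E` and both `δ` and `1 - 1
  -- / Q`; the slack makes all the inequalities strict.
  obtain ⟨δ', h1', h2'⟩ := exists_between (lt_min hδ hlt)
  have hδ' : δ' ∈ Icc 0 (1 - 1 / Q) := ⟨hEm.1.trans h1'.le, (h2'.trans_le (min_le_right _ _)).le⟩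
  have hflip : flip Q δ' < flip Q E := flip_strictAntiOn hQ hEm hδ' h1'
  refine ⟨hEm.1.trans_lt hδ, flip Q δ', ?_, hflip.trans_le (flip_mem hQ hEm).2, ?_, ?_⟩
  · rw [← hlast]
    exact flip_strictAntiOn hQ hδ' (right_mem_Icc.mpr hpos) (h2'.trans_le (min_le_right _ _))
  · rw [flip_flip hQ hδ']; exact h2'.trans_le (min_le_left _ _)
  · rw [← hER]
    have := entropy_strictMonoOn hQ (flip_mem hQ hδ') (flip_mem hQ hEm) hflip
    linarith

end Entropy

end Typewriter

namespace Typewriter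

/-! ### Passage to exponents -/

section Asymptotics

open Topology

theorem two_rpow_lovaszRate {q : ℕ} (hq3 : 3 ≤ q) :
    (2 : ℝ) ^ lovaszRate q
      = q * Real.cos (Real.pi / q) / (1 + Real.cos (Real.pi / q)) := by
  have := (cos_pi_div_pos hq3).1
  have : (0 : ℝ) < q := by positivity
  rw [lovaszRate, Real.rpow_logb two_pos (by norm_num) (by positivity)]

/-- The size of a code whose confusable pairs have relative distance at least `δ`. -/
theorem card_le_of_flip_lt {q : ℕ} [NeZero q] (hq : Odd q) (hq3 : 3 ≤ q) {δ τ : ℝ} (hδ : 0 < δ)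
    (h0 : 0 < τ) (h1 : τ < 1 - 1 / altSize q) (hτ : flip (altSize q) τ < δ) :
    ∃ K : ℝ, ∀ᶠ n : ℕ in atTop, ∀ (ι : Type) [Fintype ι] (c : ι → Fin n → ZMod q),
      (∀ i j, i ≠ j → (∀ k, c i k - c j k = 0 ∨ c i k - c j k = 1 ∨ c i k - c j k = -1) →
        δ * n ≤ hammingDist (c i) (c j)) →
      (Fintype.card ι : ℝ) ≤ K * 2 ^ ((n : ℝ) * (lovaszRate q + entropy (altSize q) τ)) := by
  obtain ⟨hC0, hC1⟩ := cos_pi_div_pos hq3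
  have hq0 : (0 : ℝ) < q := by positivity
  have hrate := two_rpow_lovaszRate hq3
  set Q := altSize q with hQ
  set C := Real.cos (Real.pi / q) with hC
  have hQC : Q = 1 + 1 / C := rfl
  have hQ1 : 1 < Q := by rw [hQC]; have : 0 < 1 / C := by positivity
                         linarith
  have hτ1 : τ < 1 := by have : 0 < 1 / Q := by positivity
                         linarith
  -- The condition `flip Q τ < δ` multiplied by `Q C = 1 + C`: the limiting eigenvalue per
  -- coordinate exceeds `lam / n`.
  have hgap : 0 < 2 * √(τ * (1 - τ) * C) * 1 + (1 - C) * τ - (1 - (1 + C) * δ) := by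
    rw [flip, div_lt_iff₀ (by linarith)] at hτ
    have e1 : √((Q - 1) * τ * (1 - τ)) * C = √(τ * (1 - τ) * C) := by
      rw [show τ * (1 - τ) * C = (Q - 1) * τ * (1 - τ) * C ^ 2 by rw [hQC]; field_simp; ring,
        Real.sqrt_mul' _ (sq_nonneg C), Real.sqrt_sq hC0.le]
    have e2 := mul_lt_mul_of_pos_right hτ hC0
    have e3 : Q * C = C + 1 := by rw [hQC]; field_simp
    have e4 : (Q - 1 - (Q - 2) * τ - 2 * √((Q - 1) * τ * (1 - τ))) * C
        = Q * C - C - (Q * C - 2 * C) * τ - 2 * (√((Q - 1) * τ * (1 - τ)) * C) := by ring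
    rw [e4, e1, e3, mul_assoc δ, e3] at e2
    linarith
  -- A window of fixed length suffices: its loss factor `cos (π / (m + 2))` is close enough to `1`.
  obtain ⟨m, hm⟩ : ∃ m : ℕ, 0 < 2 * √(τ * (1 - τ) * C) * Real.cos (Real.pi / (m + 2))
      + (1 - C) * τ - (1 - (1 + C) * δ) := by
    have hcos : Tendsto (fun m : ℕ => Real.cos (Real.pi / (m + 2))) atTop (𝓝 1) := by
      rw [← Real.cos_zero]
      refine (Real.continuous_cos.tendsto 0).comp (Tendsto.const_div_atTop ?_ _)
      exact tendsto_atTop_add_const_right _ _ tendsto_natCast_atTop_atTop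
    have := ((hcos.const_mul (2 * √(τ * (1 - τ) * C))).add_const ((1 - C) * τ)).sub_const
      (1 - (1 + C) * δ)
    exact (this.eventually (lt_mem_nhds hgap)).exists
  set η := 2 * √(τ * (1 - τ) * C) * Real.cos (Real.pi / (m + 2))
      + (1 - C) * τ - (1 - (1 + C) * δ) with hη
  have hfloor : Tendsto (fun n : ℕ => (⌊τ * n⌋₊ : ℝ) / n) atTop (𝓝 τ) :=
    (tendsto_nat_floor_mul_div_atTop h0.le).comp tendsto_natCast_atTop_atTop
  have hmn : Tendsto (fun n : ℕ => (m : ℝ) / n) atTop (𝓝 0) :=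
    tendsto_const_div_atTop_nhds_zero_nat _
  have hlarge : ∀ᶠ n : ℕ in atTop, m + 1 ≤ ⌊τ * n⌋₊ := by
    have : Tendsto (fun n : ℕ => τ * (n : ℝ)) atTop atTop :=
      tendsto_natCast_atTop_atTop.const_mul_atTop h0
    exact (tendsto_nat_floor_atTop.comp this).eventually_ge_atTop _
  have hlim : ∀ᶠ n : ℕ in atTop, η / 2 <
      2 * √(((⌊τ * n⌋₊ : ℝ) / n - m / n) * (1 - (⌊τ * n⌋₊ : ℝ) / n) * C)
        * Real.cos (Real.pi / (m + 2)) + (1 - C) * ((⌊τ * n⌋₊ : ℝ) / n - m / n)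
        - (1 - (1 + C) * δ) := by
    have hA := hfloor.sub hmn
    have hB := (tendsto_const_nhds (x := (1 : ℝ))).sub hfloor
    have hS := ((hA.mul hB).mul_const C).sqrt
    have := (((hS.const_mul 2).mul_const (Real.cos (Real.pi / (m + 2)))).add
      (hA.const_mul (1 - C))).sub_const (1 - (1 + C) * δ)
    refine this.eventually (lt_mem_nhds ?_)
    rw [sub_zero]
    exact half_lt_self hm
  refine ⟨(1 + C) * δ / (η / 2), ?_⟩
  filter_upwards [hlarge, hlim, eventually_gt_atTop 0] with n hn1 hn2 hn0 ι _ c hc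
  have hn0' : (0 : ℝ) < n := by exact_mod_cast hn0
  have hfl : (⌊τ * n⌋₊ : ℝ) ≤ τ * n := Nat.floor_le (by positivity)
  have hfn : ⌊τ * n⌋₊ < n := by
    have : (⌊τ * n⌋₊ : ℝ) < n := hfl.trans_lt (by nlinarith)
    exact_mod_cast this
  -- The window ends at `⌊τ n⌋`, so its support lies in the ball of radius `τ n`.
  obtain ⟨a, ha⟩ : ∃ a, ⌊τ * n⌋₊ = a + m := ⟨⌊τ * n⌋₊ - m, by omega⟩
  rw [ha] at hn1 hn2 hfl hfn
  set X := 2 * √(a * (n - a - m) * C) * Real.cos (Real.pi / (m + 2)) + (1 - C) * a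
      - (n - (1 + C) * (δ * n)) with hX
  have hXn : η / 2 * n < X := by
    have e1 : ((a + m : ℕ) : ℝ) / n - m / n = a / n := by push_cast; ring
    have e2 : 1 - ((a + m : ℕ) : ℝ) / n = (n - a - m) / n := by push_cast; field_simp; ring
    have e3 : √((a : ℝ) / n * ((n - a - m) / n) * C) = √(a * (n - a - m) * C) / n := by
      rw [show (a : ℝ) / n * ((n - a - m) / n) * C = a * (n - a - m) * C / n ^ 2 by field_simp,
        Real.sqrt_div' _ (sq_nonneg _), Real.sqrt_sq hn0'.le]
    rw [e1, e2, e3] at hn2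
    have := mul_lt_mul_of_pos_right hn2 hn0'
    refine this.trans_le (le_of_eq ?_)
    rw [hX]; field_simp
  have hX0 : 0 < X := lt_trans (by positivity) hXn
  have main := card_mul_le_window hq hq3 c hC (d := δ * n) (by positivity) hc (a := a) (m := m)
    (by omega) hfn hX0
  have hball := sum_ball_le (n := n) hQ1 h0 h1.le hfl
  have hQ1' : Q - 1 = C⁻¹ := by rw [hQC]; simp
  rw [hQ1'] at hball
  simp only [Nat.cast_le] at hball
  have hr : (2 : ℝ) ^ ((n : ℝ) * (lovaszRate q + entropy Q τ))
      = (q * C / (1 + C)) ^ n * 2 ^ ((n : ℝ) * entropy Q τ) := by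
    rw [mul_add, Real.rpow_add two_pos, mul_comm (n : ℝ) (lovaszRate q), Real.rpow_mul zero_le_two,
      Real.rpow_natCast, hrate]
  rw [hr]
  set B := (2 : ℝ) ^ ((n : ℝ) * entropy Q τ) with hB
  have hinv : ((1 + C) / (C * q)) ^ n * (q * C / (1 + C)) ^ n = 1 := by
    rw [← mul_pow]; field_simp; simp
  set u := ((1 + C) / (C * q)) ^ n with hu
  set v := (q * C / (1 + C)) ^ n with hv
  have hv0 : 0 < v := by positivity
  have hu0 : 0 < u := by positivity
  have step : (η / 2 * n) * u * Fintype.card ι ≤ (1 + C) * (δ * n) * B := by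
    refine le_trans ?_ (main.trans ?_)
    · gcongr
    · exact mul_le_mul_of_nonneg_left hball (by positivity)
  have step2 : (η / 2) * Fintype.card ι ≤ (1 + C) * δ * (v * B) := by
    have := mul_le_mul_of_nonneg_right step (show 0 ≤ v / n by positivity)
    calc (η / 2) * Fintype.card ι = (η / 2 * n) * u * Fintype.card ι * (v / n) := by
          rw [show η / 2 * n * u * Fintype.card ι * (v / n) = η / 2 * Fintype.card ι * (u * v) by
            field_simp, hinv, mul_one]
      _ ≤ (1 + C) * (δ * n) * B * (v / n) := this
      _ = _ := by field_simp
  rw [div_mul_eq_mul_div, le_div_iff₀ (by positivity)]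
  linarith

/-- Exponentially many codewords force an average error probability of at least
`2 ^ (-δ n) / 4`. -/
theorem eventually_le_avgErr {q : ℕ} [NeZero q] (hq : Odd q) (hq3 : 3 ≤ q) {R δ : ℝ}
    (h0 : lovaszRate q < R) (h1 : R ≤ lovaszRate q + Real.logb 2 (altSize q))
    (hδ : ELP1 (lovaszRate q) (altSize q) R < δ) :
    ∀ᶠ n : ℕ in atTop, ∀ c : Code q n ⌈(2 : ℝ) ^ ((n : ℝ) * R)⌉₊,
      (2 : ℝ) ^ (-(δ * n)) / 4 ≤ c.avgErr := by
  have hQ1 : 1 < altSize q := by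
    have := (cos_pi_div_pos hq3).1
    rw [altSize]
    have : 0 < 1 / Real.cos (Real.pi / q) := by positivity
    linarith
  obtain ⟨hδ0, τ, hτ0, hτ1, hτ2, hτ3⟩ := exists_radius hQ1 h0 h1 hδ
  obtain ⟨K, hK⟩ := card_le_of_flip_lt hq hq3 hδ0 hτ0 hτ1 hτ2
  have hgrow : Tendsto (fun n : ℕ => (2 : ℝ) ^ ((n : ℝ) *
      (R - (lovaszRate q + entropy (altSize q) τ)))) atTop atTop :=
    (tendsto_rpow_atTop_of_base_gt_one 2 one_lt_two).comp
      (tendsto_natCast_atTop_atTop.atTop_mul_const (sub_pos.mpr hτ3))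
  filter_upwards [hK, hgrow.eventually_gt_atTop (2 * K)] with n hn hlt c
  have hM : (2 : ℝ) ^ ((n : ℝ) * R) ≤ ⌈(2 : ℝ) ^ ((n : ℝ) * R)⌉₊ := Nat.le_ceil _
  refine c.rpow_le_avgErr hq3 (Nat.ceil_pos.mpr (by positivity)) fun A hA => ?_
  -- Otherwise the subcode `A` obeys the size bound at a rate strictly below `R`, although it keeps
  -- half of the codewords.
  by_contra! hcon
  have hcard := hn A (fun i => c.enc i) fun i j hij hconf =>
    hcon i i.2 j j.2 (fun h => hij (Subtype.ext h)) hconf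
  rw [Fintype.card_coe] at hcard
  rw [mul_sub, Real.rpow_sub two_pos, lt_div_iff₀ (by positivity)] at hlt
  linarith

theorem reliability_le {Pe : ℕ → ℕ → ℝ} {R E : ℝ}
    (h : ∀ δ, E < δ → ∀ᶠ n : ℕ in atTop,
      (2 : ℝ) ^ (-(δ * n)) / 4 ≤ Pe ⌈(2 : ℝ) ^ ((n : ℝ) * R)⌉₊ n) :
    reliability Pe R ≤ (E : EReal) := by
  refine EReal.le_of_forall_lt_iff_le.mp fun δ hδ => ?_
  obtain ⟨δ', h1, h2⟩ := exists_between (EReal.coe_lt_coe_iff.mp hδ)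
  refine limsup_le_of_le (by isBoundedDefault) ?_
  have hsmall : ∀ᶠ n : ℕ in atTop, (2 : ℝ) / n < δ - δ' :=
    (tendsto_const_div_atTop_nhds_zero_nat (2 : ℝ)).eventually (gt_mem_nhds (sub_pos.mpr h2))
  filter_upwards [h δ' h1, hsmall, eventually_gt_atTop 0] with n hn hs hn0
  have hn0' : (0 : ℝ) < n := by exact_mod_cast hn0
  set p := Pe ⌈(2 : ℝ) ^ ((n : ℝ) * R)⌉₊ n with hp
  have hp0 : 0 < p := lt_of_lt_of_le (by positivity) hn
  rw [errExponent, if_neg hp0.ne', EReal.coe_le_coe_iff]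
  -- The additive `2` is the logarithm of the factor `4`; it disappears after division by `n`.
  have hlog : Real.logb 2 (1 / p) ≤ δ' * n + 2 := by
    rw [Real.logb_le_iff_le_rpow one_lt_two (by positivity), Real.rpow_add two_pos,
      div_le_iff₀ hp0]
    have := mul_le_mul_of_nonneg_left hn (show 0 ≤ (2 : ℝ) ^ (δ' * n) * 2 ^ (2 : ℝ) by positivity)
    refine le_trans (le_of_eq ?_) this
    rw [Real.rpow_neg zero_le_two]
    have : (0 : ℝ) < 2 ^ (δ' * n) := by positivity
    field_simp
    norm_num
  calc 1 / (n : ℝ) * Real.logb 2 (1 / p) ≤ 1 / (n : ℝ) * (δ' * n + 2) := by gcongr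
    _ = δ' + 2 / n := by field_simp
    _ ≤ δ := by linarith

end Asymptotics

/-! ### Endpoints, general odd `q`, and the pentagon -/

theorem lovaszRate_add_logb {q : ℕ} (hq3 : 3 ≤ q) :
    lovaszRate q + Real.logb 2 (altSize q) = Real.logb 2 q := by
  have hC := (cos_pi_div_pos hq3).1
  have hq0 : (0 : ℝ) < q := by positivity
  have hQ : 0 < altSize q := by rw [altSize]; positivity
  rw [lovaszRate, ← Real.logb_mul (by positivity) hQ.ne', altSize]
  congr 1
  field_simp
  ring

theorem bijOn_and_reliability_le (q : ℕ) [NeZero q] (hq : Odd q) (hq3 : 3 ≤ q) :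
    BijOn (rateLP1 (lovaszRate q) (altSize q)) (Icc 0 (1 - 1 / altSize q))
        (Icc (lovaszRate q) (Real.logb 2 q)) ∧
      ∀ R : ℝ, lovaszRate q < R → R < Real.logb 2 ((q : ℝ) / 2) →
        EAvg q R ≤ (ELP1 (lovaszRate q) (altSize q) R : EReal) ∧
        EMax q R ≤ (ELP1 (lovaszRate q) (altSize q) R : EReal) := by
  have hC := (cos_pi_div_pos hq3).1
  have hq0 : (0 : ℝ) < q := by positivity
  have hQ1 : 1 < altSize q := by
    rw [altSize]
    have : 0 < 1 / Real.cos (Real.pi / q) := by positivity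
    linarith
  refine ⟨lovaszRate_add_logb hq3 ▸ rateLP1_bijOn hQ1 _, fun R h0 h1 => ?_⟩
  have hR : R ≤ lovaszRate q + Real.logb 2 (altSize q) := by
    rw [lovaszRate_add_logb hq3]
    refine h1.le.trans (Real.logb_le_logb_of_le one_lt_two (by positivity) (by linarith))
  have hM : ∀ n : ℕ, 0 < ⌈(2 : ℝ) ^ ((n : ℝ) * R)⌉₊ := fun n => Nat.ceil_pos.mpr (by positivity)
  constructor
  · refine reliability_le fun δ hδ => ?_
    filter_upwards [eventually_le_avgErr hq hq3 h0 hR hδ] with n hn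
    have : NeZero ⌈(2 : ℝ) ^ ((n : ℝ) * R)⌉₊ := ⟨(hM n).ne'⟩
    exact le_ciInf hn
  · refine reliability_le fun δ hδ => ?_
    filter_upwards [eventually_le_avgErr hq hq3 h0 hR hδ] with n hn
    have : NeZero ⌈(2 : ℝ) ^ ((n : ℝ) * R)⌉₊ := ⟨(hM n).ne'⟩
    exact le_ciInf fun c => (hn c).trans (c.avgErr_le_maxErr (hM n))

/-- Since `cos (π / 5) = (1 + √5) / 4`, its inverse is `√5 - 1`. -/
theorem altSize_five : altSize 5 = √5 := by
  have h5 : √5 ^ 2 = (5 : ℝ) := Real.sq_sqrt (by norm_num)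
  have h0 : 0 < √(5 : ℝ) := by positivity
  rw [altSize, Nat.cast_ofNat, Real.cos_pi_div_five]
  field_simp
  linarith

theorem lovaszRate_five : lovaszRate 5 = Real.logb 2 √5 := by
  have h5 : √5 ^ 2 = (5 : ℝ) := Real.sq_sqrt (by norm_num)
  have h0 : 0 < √(5 : ℝ) := by positivity
  rw [lovaszRate, Nat.cast_ofNat, Real.cos_pi_div_five]
  congr 1
  field_simp
  linarith

end Typewriter

theorem theorem2 :
    -- the channel with five inputs: the inverse function is well defined, and the bound holds
    (BijOn (Typewriter.rateLP1 (Real.logb 2 √5) √5) (Icc 0 (1 - 1 / √5))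
        (Icc (Real.logb 2 √5) (Real.logb 2 5)) ∧
      ∀ R : ℝ, Real.logb 2 √5 < R → R < Real.logb 2 (5 / 2) →
        Typewriter.EAvg 5 R ≤ (Typewriter.ELP1 (Real.logb 2 √5) √5 R : EReal) ∧
        Typewriter.EMax 5 R ≤ (Typewriter.ELP1 (Real.logb 2 √5) √5 R : EReal)) ∧
    -- the extension to any odd number of inputs
    (∀ (q : ℕ) [NeZero q], Odd q → 3 ≤ q →
      BijOn (Typewriter.rateLP1 (Typewriter.lovaszRate q) (Typewriter.altSize q))
        (Icc 0 (1 - 1 / Typewriter.altSize q))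
        (Icc (Typewriter.lovaszRate q) (Real.logb 2 q)) ∧
      ∀ R : ℝ, Typewriter.lovaszRate q < R → R < Real.logb 2 ((q : ℝ) / 2) →
        Typewriter.EAvg q R ≤
          (Typewriter.ELP1 (Typewriter.lovaszRate q) (Typewriter.altSize q) R : EReal) ∧
        Typewriter.EMax q R ≤
          (Typewriter.ELP1 (Typewriter.lovaszRate q) (Typewriter.altSize q) R : EReal)) := by
  refine ⟨?_, fun q _ hq hq3 => Typewriter.bijOn_and_reliability_le q hq hq3⟩
  have := Typewriter.bijOn_and_reliability_le 5 (by decide) (by norm_num)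
  rwa [Typewriter.altSize_five, Typewriter.lovaszRate_five, Nat.cast_ofNat] at this
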